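/- Theorem (Corrected multiplier bootstrap). Let $d\ge 0$ and, for each $n$, let $X_{n1},\dots,X_{nn}$ be random vectors in $\mathbb R^d$ (the scores) on a probability space $(\Omega_n,P_n)$. Let $\theta_0\in\mathbb R^d$, $\phi:\mathbb R^d\to\mathbb R$, $\tau_0=\phi(\theta_0)$, and put $$\bar X_n=\frac1n\sum_{i=1}^n X_{ni},\qquad \hat\Sigma_n=\frac1n\sum_{i=1}^n (X_{ni}-\bar X_n)(X_{ni}-\bar X_n)^\top,\qquad Z_n=\sqrt n(\bar X_n-\theta_0).$$ Let $\xi_{n1},\dots,\xi_{nn}$ be multipliers on the same space, i.i.d. within each row and independent of $(X_{n1},\dots,X_{nn})$, with $\mathbb E\xi_{ni}=0$, $\mathbb E\xi_{ni}^2=1$ and $\mathbb E|\xi_{ni}|^{2+\eta}<\infty$ for some $\eta>0$, and set $Z_n^\xi=n^{-1/2}\sum_{i=1}^n\xi_{ni}(X_{ni}-\bar X_n)$. Write $B_M=\{v:\|v\|\le M\}$, $d_H$ for the Hausdorff distance (equal to $\infty$ between an empty and a nonempty set), $\mathrm{BL}_1$ for the set of functions that are bounded by $1$ in absolute value and $1$-Lipschitz,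 $\mathcal L_\xi(\cdot\mid X_{n1},\dots,X_{nn})$ for the conditional law given the scores, and $d_A^2(z,S)=\inf_{v\in S}(z-v)^\top A^{-1}(z-v)$. Assume: 1. (Score regularity) There is a positive definite matrix $\Sigma$ such that $Z_n\Rightarrow Z\sim N(0,\Sigma)$, $\hat\Sigma_n\to\Sigma$ in probability, and $\max_{1\le i\le n}\|X_{ni}-\bar X_n\|/\sqrt n\to0$ in probability. 2. (Cone regularity) $\phi$ has a one-sided directional derivative $\phi'_{\theta_0}(v)=\lim_{t\downarrow0}(\phi(\theta_0+tv)-\phi(\theta_0))/t$ in every direction $v$; the set $C=\{v:\phi'_{\theta_0}(v)=0\}$ is closed; and, with $L_t=\{v:\phi(\theta_0+tv)=\tau_0\}$, $d_H(L_t\cap B_M,C\cap B_M)\to0$ as $t\downarrow0$ for every fixed $M<\infty$. 3. (Multiplier bootstrap and cone estimation) $\sup_{g\in\mathrm{BL}_1(\mathbb R^d)}\bigl|\mathbb E[g(Z_n^\xi)\mid X_{n1},\dots,X_{nn}]-\mathbb E[g(Z)]\bigr|\to0$ in probability, and $\hat C_n$ are random closed subsets of $\mathbb R^d$ with $d_H(\hat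 C_n\cap B_M,C\cap B_M)\to0$ in probability for every fixed $M<\infty$. Then $T_n^\xi=d^2_{\hat\Sigma_n}(Z_n^\xi,\hat C_n)$ satisfies $\mathcal L_\xi(T_n^\xi\mid X_{n1},\dots,X_{nn})\Rightarrow_p\mathcal L(d_\Sigma^2(Z,C))$; that is, $$\sup_{g\in\mathrm{BL}_1(\mathbb R)}\bigl|\mathbb E[g(T_n^\xi)\mid X_{n1},\dots,X_{nn}]-\mathbb E[g(d_\Sigma^2(Z,C))]\bigr|\to0\quad\text{in probability}.$$ If moreover the cumulative distribution function of $d_\Sigma^2(Z,C)$ is continuous, then $$\sup_{x\in\mathbb R}\bigl|P(T_n^\xi\le x\mid X_{n1},\dots,X_{nn})-P(d_\Sigma^2(Z,C)\le x)\bigr|\to0\quad\text{in probability}.$$ (When $\hat\Sigma_n$ is singular or $\hat C_n$ is empty, which has probability tending to zero, $T_n^\xi$ is set to $0$.) -/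

import Mathlib

open MeasureTheory ProbabilityTheory Filter Topology
open scoped ENNReal NNReal

noncomputable section

namespace ScoreProfile

/-- Euclidean space `ℝᵈ`. -/
abbrev Vec (d : ℕ) : Type := EuclideanSpace ℝ (Fin d)

/-! ### Modes of convergence -/

/-- Convergence to zero in probability of nonnegative quantities `D n`, where `D n` lives on its own
probability space `(Ω n, P n)`. -/
def VanishesInProb {Ω : ℕ → Type*} [∀ n, MeasurableSpace (Ω n)] (P : ∀ n, Measure (Ω n))
    (D : ∀ n, Ω n → ℝ≥0∞) : Prop :=
  ∀ ε : ℝ≥0∞, 0 < ε → Tendsto (fun n => P n {ω | ε ≤ D n ω}) atTop (𝓝 0)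

/-- The functions `g` with `|g| ≤ 1` and Lipschitz constant at most `1`. -/
def BL1 (E : Type*) [PseudoMetricSpace E] : Set (E → ℝ) :=
  {g | (∀ x, |g x| ≤ 1) ∧ LipschitzWith 1 g}

/-- The bounded-Lipschitz distance `sup_{g ∈ BL₁} |∫ g dμ - ∫ g dν|`. -/
def blDist {E : Type*} [PseudoMetricSpace E] [MeasurableSpace E] (μ ν : Measure E) : ℝ≥0∞ :=
  ⨆ g ∈ BL1 E, edist (∫ x, g x ∂μ) (∫ x, g x ∂ν)

/-- The Kolmogorov distance `sup_x |F_μ(x) - F_ν(x)|`. -/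
def kolmogorovDist (μ ν : Measure ℝ) : ℝ≥0∞ :=
  ⨆ x : ℝ, edist (cdf μ x) (cdf ν x)

/-- Weak convergence in probability of random measures `L n` to a deterministic limit `ν`, in the
bounded-Lipschitz metric (which metrizes weak convergence of probability measures). -/
def TendstoWeaklyInProb {E : Type*} [PseudoMetricSpace E] [MeasurableSpace E]
    {Ω : ℕ → Type*} [∀ n, MeasurableSpace (Ω n)] (P : ∀ n, Measure (Ω n))
    (L : ∀ n, Ω n → Measure E) (ν : Measure E) : Prop :=
  VanishesInProb P fun n ω => blDist (L n ω) ν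

/-! ### Score statistics of one row `x = (x₁, …, xₙ)` -/

/-- The mean `n⁻¹ ∑ xᵢ`. -/
def sampleMean {d n : ℕ} (x : Fin n → Vec d) : Vec d :=
  (n : ℝ)⁻¹ • ∑ i, x i

/-- The covariance matrix `n⁻¹ ∑ (xᵢ - x̄)(xᵢ - x̄)ᵀ`. -/
def sampleCov {d n : ℕ} (x : Fin n → Vec d) : Matrix (Fin d) (Fin d) ℝ :=
  Matrix.of fun j k => (n : ℝ)⁻¹ * ∑ i, (x i - sampleMean x) j * (x i - sampleMean x) k

/-- The normalized score mean `√n (x̄ - θ₀)`. -/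
def normalizedMean {d n : ℕ} (θ₀ : Vec d) (x : Fin n → Vec d) : Vec d :=
  √(n : ℝ) • (sampleMean x - θ₀)

/-- The multiplier statistic `n^{-1/2} ∑ wᵢ (xᵢ - x̄)` with multipliers `w`. -/
def multiplierMean {d n : ℕ} (x : Fin n → Vec d) (w : Fin n → ℝ) : Vec d :=
  (√(n : ℝ))⁻¹ • ∑ i, w i • (x i - sampleMean x)

/-- The squared Mahalanobis distance `d_A²(z, S) = inf_{v ∈ S} (z - v)ᵀ A⁻¹ (z - v)`; it is meant
for `A` positive definite and `S` closed and nonempty. -/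
def mahalSq {d : ℕ} (A : Matrix (Fin d) (Fin d) ℝ) (z : Vec d) (S : Set (Vec d)) : ℝ :=
  ⨅ v : S, (z - v.1).ofLp ⬝ᵥ (A⁻¹.mulVec (z - v.1).ofLp)

/-! ### The target map and its level sets -/

/-- The local level set `L_t = {v | φ (θ₀ + t v) = φ θ₀}`. -/
def localLevelSet {d : ℕ} (φ : Vec d → ℝ) (θ₀ : Vec d) (t : ℝ) : Set (Vec d) :=
  {v | φ (θ₀ + t • v) = φ θ₀}

/-- Hausdorff distance of the traces of `S` and `S'` on the closed ball of radius `M` about `0`. It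
is extended-valued: the distance from a nonempty set to the empty set is `∞`. -/
def truncHausdorff {d : ℕ} (M : ℝ) (S S' : Set (Vec d)) : ℝ≥0∞ :=
  Metric.hausdorffEDist (S ∩ Metric.closedBall 0 M) (S' ∩ Metric.closedBall 0 M)

/-- Level-set convergence: `C` is closed and, as `t ↓ 0`, the local level sets converge to `C`
locally in Hausdorff distance. -/
structure LevelSetConvergence {d : ℕ} (φ : Vec d → ℝ) (θ₀ : Vec d) (C : Set (Vec d)) : Prop where
  isClosed : IsClosed C
  tendsto : ∀ M : ℝ,
    Tendsto (fun t : ℝ => truncHausdorff M (localLevelSet φ θ₀ t) C) (𝓝[>] 0) (𝓝 0)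

/-- `D` is the (one-sided) directional derivative of `φ` at `θ₀`. -/
def HasDirectionalDeriv {d : ℕ} (φ : Vec d → ℝ) (θ₀ : Vec d) (D : Vec d → ℝ) : Prop :=
  ∀ v, Tendsto (fun t : ℝ => (φ (θ₀ + t • v) - φ θ₀) / t) (𝓝[>] 0) (𝓝 (D v))

/-- Cone regularity: level-set convergence holds, and the limit set is the zero set of the
directional derivative of `φ` at `θ₀`. -/
structure ConeRegularity {d : ℕ} (φ : Vec d → ℝ) (θ₀ : Vec d) (C : Set (Vec d)) : Prop where
  levelSet : LevelSetConvergence φ θ₀ C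
  eq_zeroSet : ∃ D : Vec d → ℝ, HasDirectionalDeriv φ θ₀ D ∧ C = {v | D v = 0}

/-! ### Assumptions on the score array and on the multipliers -/

section Arrays

variable {d : ℕ} {Ω : ℕ → Type*} [∀ n, MeasurableSpace (Ω n)]

/-- The `n`-th row `(X_{n1}, …, X_{nn})` of a triangular array, as a random vector. -/
def row {E : Type*} (X : ∀ n, Fin n → Ω n → E) (n : ℕ) (ω : Ω n) : Fin n → E :=
  fun i => X n i ω

/-- Score regularity of the triangular array `X` with centre `θ₀` and limiting covariance `S`. -/
structure ScoreRegularity (P : ∀ n, Measure (Ω n)) [∀ n, IsProbabilityMeasure (P n)]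
    (X : ∀ n, Fin n → Ω n → Vec d) (θ₀ : Vec d) (S : Matrix (Fin d) (Fin d) ℝ) : Prop where
  measurable : ∀ n i, Measurable (X n i)
  posDef : S.PosDef
  clt : TendstoInDistribution (fun n ω => normalizedMean θ₀ (row X n ω)) atTop id P
    (multivariateGaussian (0 : Vec d) S)
  cov : ∀ j k, VanishesInProb P fun n ω => edist (sampleCov (row X n ω) j k) (S j k)
  max : VanishesInProb P fun n ω => ⨆ i : Fin n,
    ENNReal.ofReal (‖X n i ω - sampleMean (row X n ω)‖ / √(n : ℝ))

/-- In every row the multipliers `ξ_{n1}, …, ξ_{nn}` are i.i.d. with mean zero, unit variance and a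
finite absolute moment of some order `2 + η > 2`, and they are independent of the scores. -/
structure IsMultiplierArray (P : ∀ n, Measure (Ω n))
    (X : ∀ n, Fin n → Ω n → Vec d) (ξ : ∀ n, Fin n → Ω n → ℝ) : Prop where
  measurable : ∀ n i, Measurable (ξ n i)
  indep : ∀ n, iIndepFun (ξ n) (P n)
  identDistrib : ∀ n i j, IdentDistrib (ξ n i) (ξ n j) (P n) (P n)
  indep_scores : ∀ n, IndepFun (row X n) (row ξ n) (P n)
  mean : ∀ n i, ∫ ω, ξ n i ω ∂(P n) = 0
  variance : ∀ n i, ∫ ω, ξ n i ω ^ 2 ∂(P n) = 1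
  moment : ∃ η : ℝ, 0 < η ∧ ∀ n i, Integrable (fun ω => |ξ n i ω| ^ (2 + η)) (P n)

/-- The conditional law of a statistic `T` given the scores `X_{n1}, …, X_{nn}`, as a random
measure (regular conditional distribution). -/
def condLaw {E : Type*} [MeasurableSpace E] [StandardBorelSpace E] [Nonempty E]
    (P : ∀ n, Measure (Ω n)) [∀ n, IsProbabilityMeasure (P n)]
    (X : ∀ n, Fin n → Ω n → Vec d) (T : ∀ n, Ω n → E) (n : ℕ) (ω : Ω n) : Measure E :=
  condDistrib (T n) (row X n) (P n) (row X n ω)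

/-- A random closed set: closed values, and hitting any given open set is an event. -/
structure IsRandomClosedSet {Ω' : Type*} [MeasurableSpace Ω'] (K : Ω' → Set (Vec d)) : Prop where
  isClosed : ∀ ω, IsClosed (K ω)
  measurable_hit : ∀ U : Set (Vec d), IsOpen U → MeasurableSet {ω | (K ω ∩ U).Nonempty}

/-- The multiplier bootstrap statistic `Z_n^ξ`. -/
def bootMean (X : ∀ n, Fin n → Ω n → Vec d) (ξ : ∀ n, Fin n → Ω n → ℝ) (n : ℕ) (ω : Ω n) : Vec d :=
  multiplierMean (row X n ω) (row ξ n ω)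

/-- The corrected bootstrap statistic `T_n^ξ`: the squared Mahalanobis distance, with respect to
the sample covariance, from `Z_n^ξ` to the estimated cone `Chat n`. -/
def bootStat (X : ∀ n, Fin n → Ω n → Vec d) (ξ : ∀ n, Fin n → Ω n → ℝ)
    (Chat : ∀ n, Ω n → Set (Vec d)) (n : ℕ) (ω : Ω n) : ℝ :=
  mahalSq (sampleCov (row X n ω)) (bootMean X ξ n ω) (Chat n ω)

/-- Conditional central limit theorem for the multiplier bootstrap in bounded-Lipschitz distance,
and consistency of the cone estimate `Chat`. -/
structure MultiplierBootstrap (P : ∀ n, Measure (Ω n)) [∀ n, IsProbabilityMeasure (P n)]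
    (X : ∀ n, Fin n → Ω n → Vec d) (ξ : ∀ n, Fin n → Ω n → ℝ)
    (S : Matrix (Fin d) (Fin d) ℝ) (C : Set (Vec d)) (Chat : ∀ n, Ω n → Set (Vec d)) : Prop where
  clt : VanishesInProb P fun n ω =>
    blDist (condLaw P X (bootMean X ξ) n ω) (multivariateGaussian (0 : Vec d) S)
  randomClosed : ∀ n, IsRandomClosedSet (Chat n)
  cone : ∀ M : ℝ, VanishesInProb P fun n ω => truncHausdorff M (Chat n ω) C

end Arrays

/-- The law of `d_S²(Z, C)` for `Z ∼ N(0, S)`. -/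
def limitLaw {d : ℕ} (S : Matrix (Fin d) (Fin d) ℝ) (C : Set (Vec d)) : Measure ℝ :=
  (multivariateGaussian (0 : Vec d) S).map fun z => mahalSq S z C

end ScoreProfile

end

/-!
The statistic `T = bootStat` is compared with `f (Z)`, where `Z = bootMean` and
`f z = mahalSq S z C` is the distance function of the limit, and everything is transported through
the conditional laws given the scores.

*Geometry.* The Mahalanobis distance is the infimum of the quadratic form `u ↦ ⟪u, B u⟫` with
`B = A⁻¹` over the translates `z - v`. The limit set `C` contains the origin, because the
directional derivative at `0` vanishes. Hence the infimum is at most `‖B‖ ‖z‖²`, and if `B` is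
coercive all near-minimizers lie in a ball whose radius depends only on a bound for `‖z‖`. Matching
the near-minimizers for one set by points of the other gives both the Lipschitz continuity of `f`
on balls (`exists_lipschitz_quadDist`) and the stability of the distance, uniformly over bounded
`z`, when `B` and the trace of the set on one large ball are perturbed (`exists_quadDist_stable`).

*Replacing the estimates.* Weak convergence in probability of the conditional laws of `Z` makes `Z`
tight under `P n` (`exists_eventually_measure_norm_gt_le`). On a ball the geometric stability
applies, so `T - f (Z)` tends to zero in probability (`vanishesInProb_edist_bootStat`). The
estimated cone need not be a function of the scores: this step takes place under `P n`, and the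
conditional statement follows by taking expectations.

*Conditional continuous mapping.* The conditional law of the pair `(T, Z)` couples the conditional
laws of `T` and of `f (Z)`, which bounds the difference of the two integrals of every `g ∈ BL₁` by
a conditional mean of `min 2 |T - f (Z)|` (`ae_edist_integral_condDistrib_le`). The expectation of
that mean tends to zero. Since `f` is Lipschitz on balls, each `g ∘ f` times a cutoff is Lipschitz
with a constant independent of `g`, so the bounded-Lipschitz distance passes from the laws of `Z` to
those of `f (Z)` (`exists_integral_comp_stable`). Both parts meet in
`vanishesInProb_blDist_condDistrib`. The argument needs `T` to be measurable, as conditional laws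
are meaningful only then; this is `IsRandomClosedSet.measurable_iInf`.

*Distribution functions.* A continuous distribution function is uniformly continuous, and testing
against ramp functions bounds the Kolmogorov distance by the bounded-Lipschitz distance
(`exists_kolmogorovDist_le`).
-/

namespace ScoreProfile

/-! ### Distances in a quadratic form -/

section QuadDist

variable {E : Type*} [NormedAddCommGroup E] [InnerProductSpace ℝ E]

/-- The infimum over `v ∈ S` of the quadratic form `u ↦ ⟪u, B u⟫` at `z - v`. -/
noncomputable def quadDist (B : E →L[ℝ] E) (z : E) (S : Set E) : ℝ :=
  ⨅ v : S, inner ℝ (z - v.1) (B (z - v.1))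

lemma bddBelow_quadDist {B : E →L[ℝ] E} (hB : ∀ u, 0 ≤ inner ℝ u (B u)) (z : E) (S : Set E) :
    BddBelow (Set.range fun v : S => inner ℝ (z - v.1) (B (z - v.1))) :=
  ⟨0, by rintro _ ⟨v, rfl⟩; exact hB _⟩

lemma quadDist_le {B : E →L[ℝ] E} (hB : ∀ u, 0 ≤ inner ℝ u (B u)) (z : E) {S : Set E} {v : E}
    (hv : v ∈ S) : quadDist B z S ≤ inner ℝ (z - v) (B (z - v)) :=
  ciInf_le (bddBelow_quadDist hB z S) ⟨v, hv⟩

lemma inner_apply_self_le (B : E →L[ℝ] E) (u : E) : inner ℝ u (B u) ≤ ‖B‖ * ‖u‖ ^ 2 :=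
  calc inner ℝ u (B u) ≤ ‖u‖ * ‖B u‖ := real_inner_le_norm _ _
    _ ≤ ‖u‖ * (‖B‖ * ‖u‖) := by gcongr; exact B.le_opNorm u
    _ = ‖B‖ * ‖u‖ ^ 2 := by ring

lemma inner_apply_self_sub_le (B B' : E →L[ℝ] E) (u u' : E) :
    inner ℝ u (B u) - inner ℝ u' (B' u') ≤
      ‖B - B'‖ * ‖u‖ ^ 2 + ‖B'‖ * ‖u - u'‖ * (‖u‖ + ‖u'‖) := by
  have h : inner ℝ u (B u) - inner ℝ u' (B' u') =
      inner ℝ u ((B - B') u) + (inner ℝ (u - u') (B' u) + inner ℝ u' (B' (u - u'))) := by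
    simp only [sub_apply, map_sub, inner_sub_left, inner_sub_right]
    ring
  have h1 := inner_apply_self_le (B - B') u
  have h2 : inner ℝ (u - u') (B' u) ≤ ‖u - u'‖ * (‖B'‖ * ‖u‖) :=
    (real_inner_le_norm _ _).trans (by gcongr; exact B'.le_opNorm u)
  have h3 : inner ℝ u' (B' (u - u')) ≤ ‖u'‖ * (‖B'‖ * ‖u - u'‖) :=
    (real_inner_le_norm _ _).trans (by gcongr; exact B'.le_opNorm _)
  rw [h]
  linarith

/-- One-sided stability of the quadratic distance. Coercivity of `B'` confines the
near-minimizers of `quadDist B' z' S'` to the ball of radius `R`, so only the part of `S'` in that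
ball has to be matched by points of `S`. -/
lemma quadDist_le_quadDist_add {B B' : E →L[ℝ] E} {z z' : E} {S S' : Set E} {a b c q K M R : ℝ}
    (hc : 0 < c) (hB : ∀ u, 0 ≤ inner ℝ u (B u)) (hB' : ∀ u, c * ‖u‖ ^ 2 ≤ inner ℝ u (B' u))
    (hS' : S'.Nonempty) (hq : quadDist B' z' S' ≤ q) (hR : √((q + 1) / c) + M ≤ R)
    (hz : ‖z‖ ≤ M) (hz' : ‖z'‖ ≤ M) (ha : ‖B - B'‖ ≤ a) (hK : ‖B'‖ ≤ K) (hb : 0 ≤ b)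
    (hSS' : ∀ v ∈ S', ‖v‖ ≤ R → ∃ w ∈ S, ‖w‖ ≤ R ∧ ‖(z - w) - (z' - v)‖ ≤ b) :
    quadDist B z S ≤ quadDist B' z' S' + (a * (M + R) ^ 2 + K * b * (2 * (M + R))) := by
  refine le_of_forall_pos_le_add fun ε hε => ?_
  have : Nonempty S' := hS'.to_subtype
  obtain ⟨⟨v, hv⟩, hvlt⟩ := exists_lt_of_ciInf_lt
    (lt_add_of_pos_right (quadDist B' z' S') (lt_min hε one_pos))
  simp only at hvlt
  have hε1 := min_le_left ε 1
  have hε2 := min_le_right ε 1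
  have hu' : ‖z' - v‖ ≤ √((q + 1) / c) := by
    apply Real.le_sqrt_of_sq_le
    rw [le_div_iff₀ hc]
    linarith [hB' (z' - v)]
  have hvR : ‖v‖ ≤ R := by
    have : ‖v‖ ≤ ‖z' - v‖ + ‖z'‖ := by
      have := norm_sub_le z' (z' - v)
      rw [sub_sub_cancel] at this
      linarith
    linarith
  obtain ⟨w, hw, hwR, hwb⟩ := hSS' v hv hvR
  have h1 : ‖z - w‖ ≤ M + R := (norm_sub_le _ _).trans (by linarith)
  have h2 : ‖z' - v‖ ≤ M + R := (norm_sub_le _ _).trans (by linarith)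
  have h3 := inner_apply_self_sub_le B B' (z - w) (z' - v)
  have hK0 : 0 ≤ K := (norm_nonneg _).trans hK
  have ha0 : 0 ≤ a := (norm_nonneg _).trans ha
  have h4 : ‖B - B'‖ * ‖z - w‖ ^ 2 ≤ a * (M + R) ^ 2 := by gcongr
  have h5 : ‖B'‖ * ‖(z - w) - (z' - v)‖ * (‖z - w‖ + ‖z' - v‖) ≤ K * b * (2 * (M + R)) := by
    gcongr
    linarith
  have h6 := quadDist_le hB z hw
  linarith

variable {B : E →L[ℝ] E} {C : Set E} {c : ℝ}

lemma quadDist_le_of_zero_mem (hB : ∀ u, 0 ≤ inner ℝ u (B u)) (h0 : (0 : E) ∈ C) {z : E} {M : ℝ}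
    (hz : ‖z‖ ≤ M) : quadDist B z C ≤ ‖B‖ * M ^ 2 := by
  have h := quadDist_le hB z h0
  rw [sub_zero] at h
  exact h.trans ((inner_apply_self_le B z).trans (by gcongr))

/-- On every ball the distance to a set through the origin is Lipschitz in the point. -/
lemma exists_lipschitz_quadDist (hc : 0 < c) (hB : ∀ u, c * ‖u‖ ^ 2 ≤ inner ℝ u (B u))
    (h0 : (0 : E) ∈ C) (M : ℝ) :
    ∃ L : ℝ, 0 ≤ L ∧ ∀ z z' : E, ‖z‖ ≤ M → ‖z'‖ ≤ M →
      |quadDist B z C - quadDist B z' C| ≤ L * ‖z - z'‖ := by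
  rcases lt_or_ge M 0 with hM | hM
  · exact ⟨0, le_rfl, fun z _ hz => absurd (norm_nonneg z) (by linarith)⟩
  have hB0 : ∀ u, 0 ≤ inner ℝ u (B u) := fun u => le_trans (by positivity) (hB u)
  -- the radius within which all near-minimizers lie, from the value `‖B‖ * M ^ 2` at the origin
  set R : ℝ := √((‖B‖ * M ^ 2 + 1) / c) + M with hR
  have hR0 : 0 ≤ R := by positivity
  have key : ∀ z z' : E, ‖z‖ ≤ M → ‖z'‖ ≤ M →
      quadDist B z C - quadDist B z' C ≤ ‖B‖ * (2 * (M + R)) * ‖z - z'‖ := by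
    intro z z' hz hz'
    have := quadDist_le_quadDist_add (z := z) (z' := z') (S := C) (S' := C) (a := 0)
      (b := ‖z - z'‖) hc hB0 hB ⟨0, h0⟩ (quadDist_le_of_zero_mem hB0 h0 hz') hR.ge hz hz'
      (by simp) le_rfl (norm_nonneg _) (fun v hv hvR => ⟨v, hv, hvR, by simp⟩)
    linarith
  refine ⟨‖B‖ * (2 * (M + R)), by positivity, fun z z' hz hz' => abs_sub_le_iff.2
    ⟨key z z' hz hz', ?_⟩⟩
  rw [norm_sub_rev]
  exact key z' z hz' hz

lemma continuous_quadDist (hc : 0 < c) (hB : ∀ u, c * ‖u‖ ^ 2 ≤ inner ℝ u (B u))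
    (h0 : (0 : E) ∈ C) : Continuous fun z => quadDist B z C := by
  refine continuous_iff_continuousAt.2 fun z => ?_
  obtain ⟨L, -, hL⟩ := exists_lipschitz_quadDist hc hB h0 (‖z‖ + 1)
  refine tendsto_iff_norm_sub_tendsto_zero.2 ?_
  have h1 : Tendsto (fun x => L * ‖x - z‖) (𝓝 z) (𝓝 0) := by
    have : Continuous fun x : E => L * ‖x - z‖ := by fun_prop
    simpa using this.tendsto z
  refine squeeze_zero' (Eventually.of_forall fun _ => norm_nonneg _) ?_ h1
  filter_upwards [Metric.ball_mem_nhds z one_pos] with x hx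
  refine hL x z ?_ (by linarith)
  have h2 : ‖x - z‖ < 1 := by rwa [← dist_eq_norm]
  linarith [norm_le_norm_add_norm_sub' x z]

/-- Joint stability of the distance in the form and in the set: it is uniform over points of a
ball, and needs closeness of the sets only within a sufficiently large ball. -/
lemma exists_quadDist_stable (hc : 0 < c) (hB : ∀ u, c * ‖u‖ ^ 2 ≤ inner ℝ u (B u))
    (h0 : (0 : E) ∈ C) (M : ℝ) {ε : ℝ} (hε : 0 < ε) :
    ∃ R δ : ℝ, 0 < δ ∧ ∀ (B' : E →L[ℝ] E) (z : E) (S : Set E), ‖z‖ ≤ M → ‖B' - B‖ ≤ δ →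
      Metric.hausdorffEDist (S ∩ Metric.closedBall 0 R) (C ∩ Metric.closedBall 0 R) <
        ENNReal.ofReal δ → |quadDist B' z S - quadDist B z C| ≤ ε := by
  rcases lt_or_ge M 0 with hM | hM
  · exact ⟨0, 1, one_pos, fun _ z _ hz => absurd (norm_nonneg z) (by linarith)⟩
  wlog hε1 : ε ≤ 1 generalizing ε
  · obtain ⟨R, δ, hδ, h⟩ := this one_pos le_rfl
    exact ⟨R, δ, hδ, fun B' z S h1 h2 h3 => (h B' z S h1 h2 h3).trans (not_le.1 hε1).le⟩
  have hB0 : ∀ u, 0 ≤ inner ℝ u (B u) := fun u => le_trans (by positivity) (hB u)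
  -- perturbations of size at most `c / 2` keep half of the coercivity, so both forms share the
  -- constant `c / 2`; `q` bounds both distances, since they differ by at most `ε ≤ 1`
  set q : ℝ := ‖B‖ * M ^ 2 + 1
  have hq0 : 0 ≤ q := by positivity
  set R : ℝ := √((q + 1) / (c / 2)) + M with hR
  have hR0 : 0 ≤ R := by positivity
  set Q : ℝ := (M + R) ^ 2 + (‖B‖ + 1) * (2 * (M + R)) + 1
  have hQ : 0 < Q := by positivity
  refine ⟨R, min (min 1 (c / 2)) (ε / Q), by positivity, fun B' z S hz hBB' hS => ?_⟩
  set δ : ℝ := min (min 1 (c / 2)) (ε / Q)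
  have hδ0 : 0 < δ := by positivity
  have hδ1 : δ ≤ 1 := (min_le_left _ _).trans (min_le_left _ _)
  have hδc : δ ≤ c / 2 := (min_le_left _ _).trans (min_le_right _ _)
  have hδε : δ * Q ≤ ε := (le_div_iff₀ hQ).1 (min_le_right _ _)
  have hBc : ∀ u, c / 2 * ‖u‖ ^ 2 ≤ inner ℝ u (B u) := fun u =>
    le_trans (by gcongr; linarith) (hB u)
  have hB'c : ∀ u, c / 2 * ‖u‖ ^ 2 ≤ inner ℝ u (B' u) := fun u => by
    have h1 := inner_apply_self_le (B - B') u
    rw [norm_sub_rev] at h1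
    have h2 : ‖B' - B‖ * ‖u‖ ^ 2 ≤ c / 2 * ‖u‖ ^ 2 := by gcongr; linarith
    have h3 : inner ℝ u ((B - B') u) = inner ℝ u (B u) - inner ℝ u (B' u) := by
      rw [sub_apply, inner_sub_right]
    linarith [hB u]
  have hB'0 : ∀ u, 0 ≤ inner ℝ u (B' u) := fun u => le_trans (by positivity) (hB'c u)
  have hB'n : ‖B'‖ ≤ ‖B‖ + 1 := by
    linarith [norm_le_norm_add_norm_sub' B' B]
  -- points of either set in the ball of radius `R` are matched by points of the other
  have match1 : ∀ v ∈ C, ‖v‖ ≤ R → ∃ w ∈ S, ‖w‖ ≤ R ∧ ‖(z - w) - (z - v)‖ ≤ δ := by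
    intro v hv hvR
    rw [Metric.hausdorffEDist_comm] at hS
    obtain ⟨w, ⟨hw, hwR⟩, hd⟩ := Metric.exists_edist_lt_of_hausdorffEDist_lt
      (show v ∈ C ∩ Metric.closedBall 0 R from ⟨hv, by simpa using hvR⟩) hS
    refine ⟨w, hw, by simpa using hwR, ?_⟩
    rw [edist_lt_ofReal, dist_eq_norm] at hd
    simpa using hd.le
  have match2 : ∀ v ∈ S, ‖v‖ ≤ R → ∃ w ∈ C, ‖w‖ ≤ R ∧ ‖(z - w) - (z - v)‖ ≤ δ := by
    intro v hv hvR
    obtain ⟨w, ⟨hw, hwR⟩, hd⟩ := Metric.exists_edist_lt_of_hausdorffEDist_lt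
      (show v ∈ S ∩ Metric.closedBall 0 R from ⟨hv, by simpa using hvR⟩) hS
    refine ⟨w, hw, by simpa using hwR, ?_⟩
    rw [edist_lt_ofReal, dist_eq_norm] at hd
    simpa using hd.le
  have herr : δ * (M + R) ^ 2 + (‖B‖ + 1) * δ * (2 * (M + R)) ≤ ε := by
    refine le_trans ?_ hδε
    have : δ * Q = δ * (M + R) ^ 2 + (‖B‖ + 1) * δ * (2 * (M + R)) + δ := by ring
    linarith
  have hqC : quadDist B z C ≤ ‖B‖ * M ^ 2 := quadDist_le_of_zero_mem hB0 h0 hz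
  have hle1 : quadDist B' z S ≤ quadDist B z C +
      (δ * (M + R) ^ 2 + (‖B‖ + 1) * δ * (2 * (M + R))) :=
    quadDist_le_quadDist_add (half_pos hc) hB'0 hBc ⟨0, h0⟩
      (hqC.trans (by linarith : _ ≤ q)) hR.ge hz hz hBB' (by linarith) hδ0.le match1
  obtain ⟨w, hw, -, -⟩ := match1 0 h0 (by simpa using hR0)
  have hle2 : quadDist B z C ≤ quadDist B' z S +
      (δ * (M + R) ^ 2 + (‖B‖ + 1) * δ * (2 * (M + R))) :=
    quadDist_le_quadDist_add (half_pos hc) hB0 hB'c ⟨w, hw⟩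
      (by linarith : _ ≤ q) hR.ge hz hz (by rwa [norm_sub_rev]) hB'n hδ0.le match2
  exact abs_sub_le_iff.2 ⟨by linarith, by linarith⟩

end QuadDist

/-! ### The Mahalanobis distance as a quadratic distance -/

open Matrix in
lemma mahalSq_eq_quadDist {d : ℕ} (A : Matrix (Fin d) (Fin d) ℝ) (z : Vec d) (S : Set (Vec d)) :
    mahalSq A z S = quadDist (toEuclideanCLM (n := Fin d) (𝕜 := ℝ) A⁻¹) z S := by
  simp only [mahalSq, quadDist, inner_toEuclideanCLM]

open Matrix in
/-- The coercivity constant is the minimum of the form on the unit sphere, which is empty when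
`d = 0`. -/
lemma exists_coercive_of_posDef {d : ℕ} {A : Matrix (Fin d) (Fin d) ℝ} (hA : A.PosDef) :
    ∃ c : ℝ, 0 < c ∧ ∀ u : Vec d,
      c * ‖u‖ ^ 2 ≤ inner ℝ u (toEuclideanCLM (n := Fin d) (𝕜 := ℝ) A u) := by
  set B := toEuclideanCLM (n := Fin d) (𝕜 := ℝ) A
  have hpos : ∀ u : Vec d, u ≠ 0 → 0 < inner ℝ u (B u) := fun u hu => by
    rw [inner_toEuclideanCLM]
    have := hA.dotProduct_mulVec_pos (x := u.ofLp) (by simpa using hu)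
    simpa using this
  rcases (Metric.sphere (0 : Vec d) 1).eq_empty_or_nonempty with he | hne
  · refine ⟨1, one_pos, fun u => ?_⟩
    rcases eq_or_ne u 0 with rfl | hu
    · simp
    · have : ‖u‖⁻¹ • u ∈ Metric.sphere (0 : Vec d) 1 := by
        simp [norm_smul, norm_ne_zero_iff.2 hu]
      simp [he] at this
  · obtain ⟨x, hx, hmin⟩ := (isCompact_sphere (0 : Vec d) 1).exists_isMinOn hne
      (show ContinuousOn (fun u => inner ℝ u (B u)) _ by fun_prop)
    have hx1 : ‖x‖ = 1 := by simpa using hx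
    refine ⟨inner ℝ x (B x), hpos x (by rintro rfl; simp at hx1), fun u => ?_⟩
    rcases eq_or_ne u 0 with rfl | hu
    · simp
    · have hu' : 0 < ‖u‖ := norm_pos_iff.2 hu
      have h1 : ‖u‖⁻¹ • u ∈ Metric.sphere (0 : Vec d) 1 := by
        simp [norm_smul, hu'.ne']
      have h2 : inner ℝ x (B x) ≤ inner ℝ (‖u‖⁻¹ • u) (B (‖u‖⁻¹ • u)) := hmin h1
      rw [map_smul, inner_smul_left, inner_smul_right] at h2
      simp only [conj_trivial] at h2
      calc inner ℝ x (B x) * ‖u‖ ^ 2 ≤ ‖u‖⁻¹ * (‖u‖⁻¹ * inner ℝ u (B u)) * ‖u‖ ^ 2 := by gcongr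
        _ = inner ℝ u (B u) := by field_simp

open Matrix in
lemma continuousAt_toEuclideanCLM_inv {d : ℕ} {A : Matrix (Fin d) (Fin d) ℝ} (hA : A.det ≠ 0) :
    ContinuousAt (fun A : Matrix (Fin d) (Fin d) ℝ => toEuclideanCLM (n := Fin d) (𝕜 := ℝ) A⁻¹)
      A := by
  have h1 : ContinuousAt Inv.inv A := by
    apply continuousAt_matrix_inv
    rw [Ring.inverse_eq_inv']
    exact continuousAt_inv₀ hA
  have h2 : Continuous fun A : Matrix (Fin d) (Fin d) ℝ =>
      toEuclideanCLM (n := Fin d) (𝕜 := ℝ) A :=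
    LinearMap.continuous_of_finiteDimensional
      (toEuclideanCLM (n := Fin d) (𝕜 := ℝ)).toAlgEquiv.toLinearMap
  exact h2.continuousAt.comp h1

/-! ### Measurability of the bootstrap statistic -/

section Measurability

variable {d : ℕ} {Ω' : Type*} [MeasurableSpace Ω']

/-- The infimum of a nonnegative Carathéodory integrand over a random closed set is measurable.
The infimum is below `c` iff some basic open set hits the random set and carries values of the
integrand bounded by a rational number below `c`; by continuity this bound need only be tested on
a countable dense set. -/
lemma IsRandomClosedSet.measurable_iInf {K : Ω' → Set (Vec d)} (hK : IsRandomClosedSet K)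
    {q : Ω' → Vec d → ℝ} (hq : ∀ v, Measurable fun ω => q ω v) (hqc : ∀ ω, Continuous (q ω))
    (hq0 : ∀ ω v, 0 ≤ q ω v) : Measurable fun ω => ⨅ v : K ω, q ω v.1 := by
  obtain ⟨D, hDc, hD⟩ := TopologicalSpace.exists_countable_dense (Vec d)
  have hBb := TopologicalSpace.isBasis_countableBasis (Vec d)
  have hBc := TopologicalSpace.countable_countableBasis (Vec d)
  set 𝓑 := TopologicalSpace.countableBasis (Vec d)
  refine measurable_of_Iio fun c => ?_
  have hset : (fun ω => ⨅ v : K ω, q ω v.1) ⁻¹' Set.Iio c =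
      {ω | ¬ (K ω ∩ Set.univ).Nonempty ∧ 0 < c} ∪
        ⋃ b ∈ 𝓑, ⋃ r : ℚ, {ω | (r : ℝ) < c ∧ (K ω ∩ b).Nonempty ∧ ∀ w ∈ D, w ∈ b → q ω w ≤ r} := by
    ext ω
    simp only [Set.mem_preimage, Set.mem_Iio, Set.mem_union, Set.mem_ofPred_eq, Set.mem_iUnion,
      exists_prop, Set.inter_univ]
    rcases (K ω).eq_empty_or_nonempty with he | hne
    · have : IsEmpty (K ω) := by simp [he]
      simp [Real.iInf_of_isEmpty, he]
    · have : Nonempty (K ω) := hne.to_subtype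
      simp only [hne, not_true_eq_false, false_and, false_or]
      constructor
      · intro h
        obtain ⟨⟨v, hv⟩, hvc⟩ := exists_lt_of_ciInf_lt h
        obtain ⟨r, hvr, hrc⟩ := exists_rat_btwn hvc
        obtain ⟨b, hb, hvb, hbsub⟩ := hBb.exists_subset_of_mem_open
          (show v ∈ {w | q ω w < r} from hvr) (isOpen_lt (hqc ω) continuous_const)
        exact ⟨b, hb, r, hrc, ⟨v, hv, hvb⟩, fun w _ hw => (hbsub hw).le⟩
      · rintro ⟨b, hb, r, hrc, ⟨v, hv, hvb⟩, hw⟩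
        have hcl : IsClosed {w | q ω w ≤ r} := isClosed_le (hqc ω) continuous_const
        have hv' : v ∈ closure (b ∩ D) := hD.open_subset_closure_inter (hBb.isOpen hb) hvb
        have : v ∈ {w | q ω w ≤ r} :=
          closure_minimal (fun w hwbD => hw w hwbD.2 hwbD.1) hcl hv'
        exact (ciInf_le ⟨0, by rintro _ ⟨v, rfl⟩; exact hq0 _ _⟩ (⟨v, hv⟩ : K ω)).trans_lt
          (lt_of_le_of_lt this hrc)
  rw [hset]
  refine MeasurableSet.union ?_ (MeasurableSet.biUnion hBc fun b hb =>
    MeasurableSet.iUnion fun r => ?_)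
  · exact (hK.measurable_hit _ isOpen_univ).compl.inter (MeasurableSet.const _)
  · have h : MeasurableSet {ω | ∀ w ∈ D, w ∈ b → q ω w ≤ r} := by
      simp only [Set.ofPred_forall]
      exact MeasurableSet.biInter hDc fun w _ => MeasurableSet.iInter fun _ =>
        measurableSet_le (hq w) measurable_const
    exact (MeasurableSet.const _).inter ((hK.measurable_hit b (hBb.isOpen hb)).inter h)

open Matrix in
lemma measurable_inv_apply {A : Ω' → Matrix (Fin d) (Fin d) ℝ}
    (hA : ∀ j k, Measurable fun ω => A ω j k) (j k : Fin d) :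
    Measurable fun ω => (A ω)⁻¹ j k := by
  have hA' : Measurable fun ω => (fun j k => A ω j k : Fin d → Fin d → ℝ) :=
    measurable_pi_iff.2 fun j => measurable_pi_iff.2 fun k => hA j k
  have hdet : Measurable fun ω => (A ω).det :=
    (show Continuous fun a : Fin d → Fin d → ℝ => (Matrix.of a).det from
      Continuous.matrix_det continuous_id).measurable.comp hA'
  have hadj : Measurable fun ω => (A ω).adjugate j k :=
    (show Continuous fun a : Fin d → Fin d → ℝ => (Matrix.of a).adjugate j k from
      (Continuous.matrix_adjugate continuous_id).matrix_elem j k).measurable.comp hA'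
  simp only [Matrix.inv_def, Ring.inverse_eq_inv', Matrix.smul_apply, smul_eq_mul]
  exact hdet.inv.mul hadj

open Matrix in
lemma posSemidef_sampleCov {n : ℕ} (x : Fin n → Vec d) : (sampleCov x).PosSemidef := by
  have h : sampleCov x = (n : ℝ)⁻¹ • ∑ i, vecMulVec (x i - sampleMean x).ofLp
      (star (x i - sampleMean x).ofLp) := by
    ext j k
    simp [sampleCov, Matrix.sum_apply, vecMulVec_apply]
  rw [h]
  exact (posSemidef_sum _ fun i _ => posSemidef_vecMulVec_self_star _).smul (by positivity)

lemma inner_toEuclideanCLM_inv_nonneg {A : Matrix (Fin d) (Fin d) ℝ} (hA : A.PosSemidef)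
    (u : Vec d) : 0 ≤ inner ℝ u (Matrix.toEuclideanCLM (n := Fin d) (𝕜 := ℝ) A⁻¹ u) := by
  rw [Matrix.inner_toEuclideanCLM]
  simpa using hA.inv.dotProduct_mulVec_nonneg u.ofLp

lemma measurable_mahalSq {A : Ω' → Matrix (Fin d) (Fin d) ℝ} {z : Ω' → Vec d}
    {K : Ω' → Set (Vec d)} (hA : ∀ j k, Measurable fun ω => A ω j k)
    (hA0 : ∀ ω, (A ω).PosSemidef) (hz : Measurable z) (hK : IsRandomClosedSet K) :
    Measurable fun ω => mahalSq (A ω) (z ω) (K ω) := by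
  simp only [mahalSq_eq_quadDist]
  set B : Ω' → Vec d →L[ℝ] Vec d := fun ω =>
    Matrix.toEuclideanCLM (n := Fin d) (𝕜 := ℝ) (A ω)⁻¹ with hB
  refine hK.measurable_iInf (q := fun ω v => inner ℝ (z ω - v) (B ω (z ω - v))) (fun v => ?_)
    (fun ω => ?_) fun ω v => inner_toEuclideanCLM_inv_nonneg (hA0 ω) _
  swap
  · have h : Continuous fun v => z ω - v := continuous_const.sub continuous_id
    exact h.inner ((B ω).continuous.comp h)
  simp only [hB]
  simp only [Matrix.inner_toEuclideanCLM, dotProduct, Matrix.mulVec]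
  have h : ∀ j, Measurable fun ω => (z ω - v).ofLp j := fun j => by
    have : Measurable fun ω => z ω - v := hz.sub_const v
    fun_prop
  exact Finset.measurable_sum _ fun j _ => (h j).mul <| Finset.measurable_sum _ fun k _ =>
    (measurable_inv_apply hA j k).mul (h k)

section Rows

variable {n : ℕ} {x : Ω' → Fin n → Vec d}

lemma measurable_sampleMean (hx : ∀ i, Measurable fun ω => x ω i) :
    Measurable fun ω => sampleMean (x ω) := by
  unfold sampleMean
  exact (Finset.measurable_sum _ fun i _ => hx i).const_smul (n : ℝ)⁻¹

lemma measurable_sampleCov (hx : ∀ i, Measurable fun ω => x ω i) (j k : Fin d) :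
    Measurable fun ω => sampleCov (x ω) j k := by
  have h : ∀ i (j : Fin d), Measurable fun ω => (x ω i - sampleMean (x ω)) j := fun i j => by
    have : Measurable fun ω => x ω i - sampleMean (x ω) := (hx i).sub (measurable_sampleMean hx)
    fun_prop
  exact (Finset.measurable_sum _ fun i _ => (h i j).mul (h i k)).const_mul _

lemma measurable_multiplierMean {w : Ω' → Fin n → ℝ} (hx : ∀ i, Measurable fun ω => x ω i)
    (hw : ∀ i, Measurable fun ω => w ω i) : Measurable fun ω => multiplierMean (x ω) (w ω) := by
  unfold multiplierMean
  exact (Finset.measurable_sum _ fun i _ =>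
    (hw i).smul ((hx i).sub (measurable_sampleMean hx))).const_smul (√(n : ℝ))⁻¹

end Rows

end Measurability

/-! ### The bounded-Lipschitz distance -/

lemma abs_integral_sub_le_of_blDist_lt {E : Type*} [PseudoMetricSpace E] [MeasurableSpace E]
    {ν μ : Measure E} {δ : ℝ} (h : blDist ν μ < ENNReal.ofReal δ) {g : E → ℝ} (hg : g ∈ BL1 E) :
    |∫ x, g x ∂ν - ∫ x, g x ∂μ| ≤ δ := by
  have h1 : edist (∫ x, g x ∂ν) (∫ x, g x ∂μ) < ENNReal.ofReal δ :=
    lt_of_le_of_lt (le_iSup₂ (f := fun g (_ : g ∈ BL1 E) => edist (∫ x, g x ∂ν) (∫ x, g x ∂μ))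
      g hg) h
  rw [edist_lt_ofReal, Real.dist_eq] at h1
  exact h1.le

lemma abs_integral_sub_le_mul_of_blDist_lt {E : Type*} [PseudoMetricSpace E] [MeasurableSpace E]
    {ν μ : Measure E} {δ : ℝ} (h : blDist ν μ < ENNReal.ofReal δ) {g : E → ℝ} {L : ℝ} (hL : 1 ≤ L)
    (hg1 : ∀ x, |g x| ≤ 1) (hgL : ∀ x y, |g x - g y| ≤ L * dist x y) :
    |∫ x, g x ∂ν - ∫ x, g x ∂μ| ≤ L * δ := by
  have hL0 : 0 < L := by linarith
  have hg : (fun x => L⁻¹ * g x) ∈ BL1 E := by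
    refine ⟨fun x => ?_, LipschitzWith.of_dist_le_mul fun x y => ?_⟩
    · rw [abs_mul, abs_of_pos (inv_pos.2 hL0)]
      exact mul_le_one₀ (inv_le_one_of_one_le₀ hL) (abs_nonneg _) (hg1 x)
    · rw [Real.dist_eq, ← mul_sub, abs_mul, abs_of_pos (inv_pos.2 hL0), inv_mul_le_iff₀ hL0]
      simpa using hgL x y
  have h1 := abs_integral_sub_le_of_blDist_lt h hg
  rwa [integral_const_mul, integral_const_mul, ← mul_sub, abs_mul, abs_of_pos (inv_pos.2 hL0),
    inv_mul_le_iff₀ hL0] at h1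

section Cutoff

variable {E : Type*} [NormedAddCommGroup E]

/-- The continuous cutoff equal to `1` on the ball of radius `M`, to `0` off the ball of radius
`M + 1`, and affine in the norm between. -/
noncomputable def cutoff (M : ℝ) (z : E) : ℝ := max 0 (min 1 (M + 1 - ‖z‖))

lemma cutoff_nonneg (M : ℝ) (z : E) : 0 ≤ cutoff M z := le_max_left _ _

lemma cutoff_le_one (M : ℝ) (z : E) : cutoff M z ≤ 1 := max_le zero_le_one (min_le_left _ _)

lemma cutoff_eq_one {M : ℝ} {z : E} (hz : ‖z‖ ≤ M) : cutoff M z = 1 := by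
  rw [cutoff, min_eq_left (by linarith), max_eq_right zero_le_one]

lemma cutoff_eq_zero {M : ℝ} {z : E} (hz : M + 1 ≤ ‖z‖) : cutoff M z = 0 :=
  max_eq_left ((min_le_right _ _).trans (by linarith))

lemma lipschitzWith_cutoff (M : ℝ) : LipschitzWith 1 (cutoff M : E → ℝ) := by
  have h : LipschitzWith 1 fun z : E => M + 1 - ‖z‖ := by
    refine LipschitzWith.of_dist_le_mul fun x y => ?_
    rw [Real.dist_eq, dist_eq_norm, NNReal.coe_one, one_mul, sub_sub_sub_cancel_left, abs_sub_comm]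
    exact abs_norm_sub_norm_le x y
  exact (h.const_min 1).const_max 0

lemma abs_cutoff_sub_le (M : ℝ) (x y : E) : |cutoff M x - cutoff M y| ≤ ‖x - y‖ := by
  simpa [Real.dist_eq, dist_eq_norm] using (lipschitzWith_cutoff M).dist_le_mul x y

lemma cutoff_mem_BL1 (M : ℝ) : (cutoff M : E → ℝ) ∈ BL1 E :=
  ⟨fun x => abs_le.2 ⟨by linarith [cutoff_nonneg M x], cutoff_le_one M x⟩, lipschitzWith_cutoff M⟩

variable [MeasurableSpace E] [BorelSpace E]

lemma measurable_cutoff (M : ℝ) : Measurable (cutoff M : E → ℝ) :=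
  (lipschitzWith_cutoff M).continuous.measurable

lemma integrable_of_abs_le_one {α : Type*} [MeasurableSpace α] {ν : Measure α} [IsFiniteMeasure ν]
    {g : α → ℝ} (hg : Measurable g) (hg1 : ∀ x, |g x| ≤ 1) : Integrable g ν :=
  Integrable.of_bound hg.aestronglyMeasurable 1 (ae_of_all _ hg1)

lemma integrable_cutoff (M : ℝ) (ν : Measure E) [IsFiniteMeasure ν] :
    Integrable (cutoff M : E → ℝ) ν :=
  integrable_of_abs_le_one (measurable_cutoff M) (cutoff_mem_BL1 M).1

lemma exists_one_sub_integral_cutoff_le (μ : Measure E) [IsProbabilityMeasure μ] {ε : ℝ}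
    (hε : 0 < ε) : ∃ M : ℝ, 0 ≤ M ∧ 1 - ε ≤ ∫ z, cutoff M z ∂μ := by
  have h : Tendsto (fun n : ℕ => ∫ z, cutoff (n : ℝ) z ∂μ) atTop (𝓝 (∫ _, (1 : ℝ) ∂μ)) := by
    refine tendsto_integral_of_dominated_convergence (fun _ => 1)
      (fun n => (measurable_cutoff _).aestronglyMeasurable) (integrable_const _)
      (fun n => ae_of_all _ (cutoff_mem_BL1 _).1) (ae_of_all _ fun z => ?_)
    refine tendsto_const_nhds.congr' ?_
    filter_upwards [eventually_ge_atTop ⌈‖z‖⌉₊] with n hn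
    exact (cutoff_eq_one (Nat.ceil_le.1 hn)).symm
  rw [integral_const, probReal_univ, one_smul] at h
  obtain ⟨n, hn⟩ := (h.eventually (lt_mem_nhds (sub_lt_self 1 hε))).exists
  exact ⟨n, n.cast_nonneg, hn.le⟩

/-- Uniform tightness near `μ` in the bounded-Lipschitz distance. -/
lemma exists_tight_of_blDist_lt (μ : Measure E) [IsProbabilityMeasure μ] {ε : ℝ} (hε : 0 < ε) :
    ∃ M δ : ℝ, 0 < δ ∧ ∀ ν : Measure E, IsProbabilityMeasure ν → blDist ν μ < ENNReal.ofReal δ →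
      ν {z | M < ‖z‖} ≤ ENNReal.ofReal ε := by
  obtain ⟨M, hM, hMμ⟩ := exists_one_sub_integral_cutoff_le μ (half_pos hε)
  refine ⟨M + 1, ε / 2, half_pos hε, fun ν _ hν => ?_⟩
  have h1 := (abs_le.1 (abs_integral_sub_le_of_blDist_lt hν (cutoff_mem_BL1 M))).1
  have hms : MeasurableSet {z : E | M + 1 < ‖z‖} := measurableSet_lt measurable_const
    measurable_norm
  have h2 : ν.real {z | M + 1 < ‖z‖} ≤ 1 - ∫ z, cutoff M z ∂ν := by
    calc ν.real {z | M + 1 < ‖z‖} = ∫ z, Set.indicator {z : E | M + 1 < ‖z‖} 1 z ∂ν := by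
          rw [integral_indicator_one hms]
      _ ≤ ∫ z, (1 - cutoff M z) ∂ν := by
          refine integral_mono ((integrable_const (1 : ℝ)).indicator hms)
            ((integrable_const 1).sub (integrable_cutoff M ν)) fun z => ?_
          by_cases hz : M + 1 < ‖z‖
          · simp [hz, cutoff_eq_zero hz.le]
          · simpa [hz] using cutoff_le_one M z
      _ = 1 - ∫ z, cutoff M z ∂ν := by
          rw [integral_sub (integrable_const 1) (integrable_cutoff M ν)]; simp
  rw [← ofReal_measureReal]
  exact ENNReal.ofReal_le_ofReal (by linarith)

/-- Continuous mapping in the bounded-Lipschitz distance, for a map that is Lipschitz on balls: the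
test functions `g ∘ f`, `g ∈ BL₁`, become uniformly Lipschitz after multiplication by a cutoff. -/
lemma exists_integral_comp_stable (μ : Measure E) [IsProbabilityMeasure μ] {f : E → ℝ}
    (hf : Measurable f) (hfL : ∀ M : ℝ, ∃ L : ℝ, 0 ≤ L ∧ ∀ z z' : E, ‖z‖ ≤ M → ‖z'‖ ≤ M →
      |f z - f z'| ≤ L * ‖z - z'‖) {ε : ℝ} (hε : 0 < ε) :
    ∃ δ : ℝ, 0 < δ ∧ ∀ ν : Measure E, IsProbabilityMeasure ν → blDist ν μ < ENNReal.ofReal δ →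
      ∀ g ∈ BL1 ℝ, |∫ z, g (f z) ∂ν - ∫ z, g (f z) ∂μ| ≤ ε := by
  obtain ⟨M, hM, hMμ⟩ := exists_one_sub_integral_cutoff_le μ (show 0 < ε / 4 by linarith)
  obtain ⟨L, hL0, hL⟩ := hfL (M + 1)
  refine ⟨ε / (2 * (L + 2)), by positivity, fun ν _ hν g hg => ?_⟩
  set δ := ε / (2 * (L + 2)) with hδ
  have hδε : (L + 2) * δ = ε / 2 := by rw [hδ]; field_simp
  have hgm : Measurable g := hg.2.continuous.measurable
  have hgL : ∀ s t, |g s - g t| ≤ |s - t| := fun s t => by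
    simpa [Real.dist_eq] using hg.2.dist_le_mul s t
  have hgf : ∀ ρ : Measure E, IsProbabilityMeasure ρ → Integrable (fun z => g (f z)) ρ :=
    fun ρ _ => integrable_of_abs_le_one (hgm.comp hf) fun z => hg.1 _
  have hcb : ∀ z : E, |cutoff M z * g (f z)| ≤ 1 := fun z => by
    rw [abs_mul]
    exact mul_le_one₀ ((cutoff_mem_BL1 M).1 z) (abs_nonneg _) (hg.1 _)
  have hcgf : ∀ ρ : Measure E, IsProbabilityMeasure ρ →
      Integrable (fun z => cutoff M z * g (f z)) ρ := fun ρ _ =>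
    integrable_of_abs_le_one ((measurable_cutoff M).mul (hgm.comp hf)) hcb
  -- removing the cutoff costs at most the mass that the cutoff removes
  have htail : ∀ ρ : Measure E, IsProbabilityMeasure ρ →
      |∫ z, g (f z) ∂ρ - ∫ z, cutoff M z * g (f z) ∂ρ| ≤ 1 - ∫ z, cutoff M z ∂ρ := fun ρ hρ => by
    rw [← integral_sub (hgf ρ hρ) (hcgf ρ hρ)]
    calc |∫ z, (g (f z) - cutoff M z * g (f z)) ∂ρ|
        ≤ ∫ z, |g (f z) - cutoff M z * g (f z)| ∂ρ := abs_integral_le_integral_abs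
      _ ≤ ∫ z, (1 - cutoff M z) ∂ρ := by
          refine integral_mono ((hgf ρ hρ).sub (hcgf ρ hρ)).abs
            ((integrable_const 1).sub (integrable_cutoff M ρ)) fun z => ?_
          have h0 : 0 ≤ 1 - cutoff M z := by linarith [cutoff_le_one M z]
          calc |g (f z) - cutoff M z * g (f z)| = (1 - cutoff M z) * |g (f z)| := by
                rw [← one_sub_mul, abs_mul, abs_of_nonneg h0]
            _ ≤ 1 - cutoff M z := mul_le_of_le_one_right h0 (hg.1 _)
      _ = 1 - ∫ z, cutoff M z ∂ρ := by
          rw [integral_sub (integrable_const 1) (integrable_cutoff M ρ)]; simp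
  -- the product with the cutoff is Lipschitz; a point off the larger ball contributes nothing
  have hlip : ∀ x y : E, ‖x‖ ≤ M + 1 →
      |cutoff M x * g (f x) - cutoff M y * g (f y)| ≤ (L + 1) * dist x y := fun x y hx => by
    rw [dist_eq_norm]
    rcases le_total ‖y‖ (M + 1) with hy | hy
    · have h1 : cutoff M x * g (f x) - cutoff M y * g (f y) =
          cutoff M x * (g (f x) - g (f y)) + (cutoff M x - cutoff M y) * g (f y) := by ring
      have h2 : |cutoff M x * (g (f x) - g (f y))| ≤ 1 * (L * ‖x - y‖) := by
        rw [abs_mul]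
        exact mul_le_mul ((cutoff_mem_BL1 M).1 x) ((hgL _ _).trans (hL x y hx hy))
          (abs_nonneg _) zero_le_one
      have h3 : |(cutoff M x - cutoff M y) * g (f y)| ≤ ‖x - y‖ * 1 := by
        rw [abs_mul]
        exact mul_le_mul (abs_cutoff_sub_le M x y) (hg.1 _) (abs_nonneg _) (norm_nonneg _)
      rw [h1]
      linarith [abs_add_le (cutoff M x * (g (f x) - g (f y))) ((cutoff M x - cutoff M y) * g (f y))]
    · have h1 := abs_cutoff_sub_le M x y
      rw [cutoff_eq_zero hy, sub_zero] at h1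
      rw [cutoff_eq_zero hy, zero_mul, sub_zero, abs_mul]
      calc |cutoff M x| * |g (f x)| ≤ ‖x - y‖ * 1 :=
            mul_le_mul h1 (hg.1 _) (abs_nonneg _) (norm_nonneg _)
        _ ≤ (L + 1) * ‖x - y‖ := by nlinarith [norm_nonneg (x - y)]
  have hlip' : ∀ x y : E,
      |cutoff M x * g (f x) - cutoff M y * g (f y)| ≤ (L + 1) * dist x y := fun x y => by
    rcases le_total ‖x‖ (M + 1) with hx | hx
    · exact hlip x y hx
    · rcases le_total ‖y‖ (M + 1) with hy | hy
      · rw [abs_sub_comm, dist_comm]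
        exact hlip y x hy
      · rw [cutoff_eq_zero hx, cutoff_eq_zero hy]
        simp only [zero_mul, sub_zero, abs_zero]
        positivity
  have h1 := abs_le.1 (htail ν inferInstance)
  have h2 := abs_le.1 (htail μ inferInstance)
  have h3 := abs_le.1 (abs_integral_sub_le_mul_of_blDist_lt hν (by linarith) hcb hlip')
  have h4 := abs_le.1 (abs_integral_sub_le_of_blDist_lt hν (cutoff_mem_BL1 M))
  exact abs_le.2 ⟨by linarith, by linarith⟩

end Cutoff

/-! ### Kolmogorov distance -/

/-- A continuous distribution function is uniformly continuous, in one-step form. -/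
lemma exists_cdf_add_sub_le {ν : Measure ℝ} (hν : Continuous fun x => cdf ν x) {ε : ℝ}
    (hε : 0 < ε) : ∃ h : ℝ, 0 < h ∧ h ≤ 1 ∧ ∀ x, cdf ν (x + h) - cdf ν x ≤ ε := by
  obtain ⟨a, ha⟩ := ((tendsto_cdf_atBot ν).eventually (gt_mem_nhds hε)).exists_forall_of_atBot
  obtain ⟨b, hb⟩ := ((tendsto_cdf_atTop ν).eventually
    (lt_mem_nhds (sub_lt_self 1 hε))).exists_forall_of_atTop
  obtain ⟨δ, hδ, h⟩ := Metric.uniformContinuousOn_iff.1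
    ((isCompact_Icc (a := a - 1) (b := b + 1)).uniformContinuousOn_of_continuous hν.continuousOn)
    ε hε
  refine ⟨min (δ / 2) 1, by positivity, min_le_right _ _, fun x => ?_⟩
  have h1 : min (δ / 2) 1 ≤ 1 := min_le_right _ _
  have h2 : min (δ / 2) 1 ≤ δ / 2 := min_le_left _ _
  have h0 : 0 < min (δ / 2) 1 := by positivity
  set k := min (δ / 2) 1
  rcases le_total (x + k) a with hxa | hxa
  · linarith [ha _ hxa, cdf_nonneg ν x]
  rcases le_total b x with hxb | hxb
  · linarith [hb _ hxb, cdf_le_one ν (x + k)]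
  · have := h (x + k) ⟨by linarith, by linarith⟩ x ⟨by linarith, by linarith⟩
      (by rw [Real.dist_eq, add_sub_cancel_left, abs_of_pos h0]; linarith)
    rw [Real.dist_eq] at this
    exact ((le_abs_self _).trans this.le)

/-- Comparing distribution functions through a ramp of width `h`, which is `h⁻¹` times a function in
`BL₁`. -/
lemma cdf_le_cdf_add_of_blDist_lt {ρ ν : Measure ℝ} [IsProbabilityMeasure ρ]
    [IsProbabilityMeasure ν] {δ h : ℝ} (hh : 0 < h) (h1 : h ≤ 1)
    (hd : ∀ g ∈ BL1 ℝ, |∫ t, g t ∂ρ - ∫ t, g t ∂ν| ≤ δ) (x : ℝ) :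
    cdf ρ x ≤ cdf ν (x + h) + δ / h := by
  set g : ℝ → ℝ := fun t => max 0 (min h (x + h - t)) with hg
  have hg0 : ∀ t, 0 ≤ g t := fun t => le_max_left _ _
  have hgh : ∀ t, g t ≤ h := fun t => max_le hh.le (min_le_left _ _)
  have hgBL : g ∈ BL1 ℝ := by
    refine ⟨fun t => abs_le.2 ⟨by linarith [hg0 t], (hgh t).trans h1⟩, ?_⟩
    have : LipschitzWith 1 fun t : ℝ => x + h - t :=
      LipschitzWith.of_dist_le_mul fun s t => by
        rw [Real.dist_eq, Real.dist_eq, sub_sub_sub_cancel_left, abs_sub_comm]; simp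
    exact (this.const_min h).const_max 0
  have hgm : Measurable g := hgBL.2.continuous.measurable
  have hgi : ∀ σ : Measure ℝ, IsProbabilityMeasure σ → Integrable g σ := fun σ _ =>
    integrable_of_abs_le_one hgm hgBL.1
  have hlow : h * cdf ρ x ≤ ∫ t, g t ∂ρ := by
    calc h * cdf ρ x = ∫ t, Set.indicator (Set.Iic x) (fun _ => h) t ∂ρ := by
          rw [integral_indicator_const _ measurableSet_Iic, cdf_eq_real, smul_eq_mul, mul_comm]
      _ ≤ ∫ t, g t ∂ρ := by
          refine integral_mono ((integrable_const h).indicator measurableSet_Iic)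
            (hgi ρ inferInstance) fun t => ?_
          by_cases ht : t ≤ x
          · rw [Set.indicator_of_mem (show t ∈ Set.Iic x from ht)]
            simp only [hg]
            rw [min_eq_left (by linarith)]
            exact le_max_right _ _
          · rw [Set.indicator_of_notMem (show t ∉ Set.Iic x from ht)]
            exact hg0 t
  have hup : ∫ t, g t ∂ν ≤ h * cdf ν (x + h) := by
    calc ∫ t, g t ∂ν ≤ ∫ t, Set.indicator (Set.Iic (x + h)) (fun _ => h) t ∂ν := by
          refine integral_mono (hgi ν inferInstance)
            ((integrable_const h).indicator measurableSet_Iic) fun t => ?_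
          by_cases ht : t ≤ x + h
          · rw [Set.indicator_of_mem (show t ∈ Set.Iic (x + h) from ht)]
            exact hgh t
          · rw [Set.indicator_of_notMem (show t ∉ Set.Iic (x + h) from ht)]
            exact max_le le_rfl ((min_le_right _ _).trans (by linarith [not_le.1 ht]))
      _ = h * cdf ν (x + h) := by
          rw [integral_indicator_const _ measurableSet_Iic, cdf_eq_real, smul_eq_mul, mul_comm]
  have h3 := (abs_le.1 (hd g hgBL)).2
  have h4 : h * cdf ρ x ≤ h * (cdf ν (x + h) + δ / h) := by
    rw [mul_add, mul_div_cancel₀ _ hh.ne']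
    linarith
  exact le_of_mul_le_mul_left h4 hh

/-- At a limit with a continuous distribution function, bounded-Lipschitz closeness forces
Kolmogorov closeness. -/
lemma exists_kolmogorovDist_le {ν : Measure ℝ} [IsProbabilityMeasure ν]
    (hν : Continuous fun x => cdf ν x) {ε : ℝ} (hε : 0 < ε) :
    ∃ δ : ℝ, 0 < δ ∧ ∀ ρ : Measure ℝ, IsProbabilityMeasure ρ → blDist ρ ν < ENNReal.ofReal δ →
      kolmogorovDist ρ ν ≤ ENNReal.ofReal ε := by
  obtain ⟨h, hh, h1, hstep⟩ := exists_cdf_add_sub_le hν (half_pos hε)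
  refine ⟨h * (ε / 2), by positivity, fun ρ _ hρ => iSup_le fun x => ?_⟩
  have hd := fun g hg => abs_integral_sub_le_of_blDist_lt (g := g) hρ hg
  have hup := cdf_le_cdf_add_of_blDist_lt hh h1 hd x
  have hlow := cdf_le_cdf_add_of_blDist_lt (ρ := ν) (ν := ρ) hh h1
    (fun g hg => by rw [abs_sub_comm]; exact hd g hg) (x - h)
  have hs := hstep (x - h)
  rw [mul_div_cancel_left₀ _ hh.ne'] at hup hlow
  rw [sub_add_cancel] at hlow hs
  rw [edist_dist, Real.dist_eq]
  exact ENNReal.ofReal_le_ofReal (abs_le.2 ⟨by linarith, by linarith [hstep x]⟩)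

/-! ### Coupling of conditional laws -/

section Coupling

lemma edist_integral_le_lintegral_min {F : Type*} [MeasurableSpace F]
    {K : Measure (ℝ × F)} [IsProbabilityMeasure K]
    {f : F → ℝ} (hf : Measurable f) {g : ℝ → ℝ} (hg : g ∈ BL1 ℝ) :
    edist (∫ p, g p.1 ∂K) (∫ p, g (f p.2) ∂K) ≤ ∫⁻ p, min 2 (edist p.1 (f p.2)) ∂K := by
  have hgm : Measurable g := hg.2.continuous.measurable
  have hi1 : Integrable (fun p : ℝ × F => g p.1) K :=
    integrable_of_abs_le_one (hgm.comp measurable_fst) fun _ => hg.1 _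
  have hi2 : Integrable (fun p : ℝ × F => g (f p.2)) K :=
    integrable_of_abs_le_one (hgm.comp (hf.comp measurable_snd)) fun _ => hg.1 _
  rw [edist_eq_enorm_sub, ← integral_sub hi1 hi2]
  refine (enorm_integral_le_lintegral_enorm _).trans (lintegral_mono fun p => ?_)
  rw [← edist_eq_enorm_sub]
  refine le_min ?_ (by simpa using hg.2.edist_le_mul p.1 (f p.2))
  rw [edist_dist, Real.dist_eq]
  refine (ENNReal.ofReal_le_ofReal (q := 2) ?_).trans (by simp)
  have h1 := abs_le.1 (hg.1 p.1)
  have h2 := abs_le.1 (hg.1 (f p.2))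
  exact abs_le.2 ⟨by linarith, by linarith⟩

variable {Ω' β F : Type*} [MeasurableSpace Ω'] [MeasurableSpace β]
  [MeasurableSpace F] [StandardBorelSpace F] [Nonempty F]

lemma ae_condDistrib_comp_eq {F' : Type*} [MeasurableSpace F'] [StandardBorelSpace F']
    [Nonempty F'] (P : Measure Ω') [IsProbabilityMeasure P] {X : Ω' → β} (hX : Measurable X)
    {Y : Ω' → F} (hY : Measurable Y) {f : F → F'} (hf : Measurable f) :
    ∀ᵐ ω ∂P, condDistrib (fun ω => f (Y ω)) X P (X ω) = (condDistrib Y X P (X ω)).map f := by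
  have h := ae_of_ae_map hX.aemeasurable (condDistrib_comp (μ := P) X hY.aemeasurable hf)
  filter_upwards [h] with ω hω
  rw [← Kernel.map_apply _ hf]
  exact hω

lemma lintegral_condDistrib (P : Measure Ω') [IsProbabilityMeasure P] {X : Ω' → β}
    (hX : Measurable X) {Y : Ω' → F} (hY : Measurable Y) {h : F → ℝ≥0∞} (hh : Measurable h) :
    ∫⁻ ω, ∫⁻ y, h y ∂(condDistrib Y X P (X ω)) ∂P = ∫⁻ ω, h (Y ω) ∂P := by
  rw [← lintegral_map hh hY, ← condDistrib_comp_map (μ := P) hX.aemeasurable hY.aemeasurable,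
    Measure.lintegral_bind (Kernel.aemeasurable _) hh.aemeasurable,
    lintegral_map (hh.lintegral_kernel) hX]

/-- The conditional law of a pair `(T, Z)` couples the conditional laws of `T` and of `Z`. Being one
measure, it controls all test functions of `BL₁` off a single null set. -/
lemma ae_edist_integral_condDistrib_le (P : Measure Ω') [IsProbabilityMeasure P] {X : Ω' → β}
    (hX : Measurable X) {T : Ω' → ℝ} (hT : Measurable T) {Z : Ω' → F} (hZ : Measurable Z)
    {f : F → ℝ} (hf : Measurable f) :
    ∀ᵐ ω ∂P, ∀ g ∈ BL1 ℝ,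
      edist (∫ t, g t ∂(condDistrib T X P (X ω))) (∫ z, g (f z) ∂(condDistrib Z X P (X ω))) ≤
        ∫⁻ p, min 2 (edist p.1 (f p.2)) ∂(condDistrib (fun ω => (T ω, Z ω)) X P (X ω)) := by
  filter_upwards [ae_condDistrib_comp_eq P hX (hT.prodMk hZ) measurable_fst,
    ae_condDistrib_comp_eq P hX (hT.prodMk hZ) measurable_snd] with ω h1 h2 g hg
  have hgm : Measurable g := hg.2.continuous.measurable
  have hgf : Measurable fun z => g (f z) := hgm.comp hf
  rw [h1, h2, integral_map measurable_fst.aemeasurable hgm.aestronglyMeasurable,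
    integral_map measurable_snd.aemeasurable hgf.aestronglyMeasurable]
  exact edist_integral_le_lintegral_min hf hg

end Coupling

/-! ### Convergence to zero in probability -/

section InProb

variable {Ω : ℕ → Type*} [∀ n, MeasurableSpace (Ω n)] {P : ∀ n, Measure (Ω n)}

lemma vanishesInProb_of_ofReal {D : ∀ n, Ω n → ℝ≥0∞}
    (h : ∀ ε : ℝ, 0 < ε → Tendsto (fun n => P n {ω | ENNReal.ofReal ε ≤ D n ω}) atTop (𝓝 0)) :
    VanishesInProb P D := by
  intro ε hε
  have hm : min ε 1 ≠ ⊤ := ne_top_of_le_ne_top ENNReal.one_ne_top (min_le_right _ _)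
  refine tendsto_of_tendsto_of_tendsto_of_le_of_le tendsto_const_nhds
    (h (min ε 1).toReal (ENNReal.toReal_pos (lt_min hε one_pos).ne' hm)) (fun _ => zero_le)
    fun n => measure_mono fun ω hω => ?_
  simp only [Set.mem_ofPred_eq, ENNReal.ofReal_toReal hm] at hω ⊢
  exact (min_le_left _ _).trans hω

lemma VanishesInProb.tendsto_ofReal {D : ∀ n, Ω n → ℝ≥0∞} (h : VanishesInProb P D) {ε : ℝ}
    (hε : 0 < ε) : Tendsto (fun n => P n {ω | ENNReal.ofReal ε ≤ D n ω}) atTop (𝓝 0) :=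
  h _ (ENNReal.ofReal_pos.2 hε)

/-- Transfer of convergence in probability along a continuity-type bound. -/
lemma VanishesInProb.of_forall_exists {D D' : ∀ n, Ω n → ℝ≥0∞} (h : VanishesInProb P D)
    (hD : ∀ ε : ℝ, 0 < ε → ∃ δ : ℝ, 0 < δ ∧ ∀ n ω, D n ω < ENNReal.ofReal δ →
      D' n ω ≤ ENNReal.ofReal ε) : VanishesInProb P D' := by
  refine vanishesInProb_of_ofReal fun ε hε => ?_
  obtain ⟨δ, hδ, hDδ⟩ := hD (ε / 2) (half_pos hε)
  refine tendsto_of_tendsto_of_tendsto_of_le_of_le tendsto_const_nhds (h.tendsto_ofReal hδ)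
    (fun _ => zero_le) fun n => measure_mono fun ω hω => ?_
  by_contra hlt
  have h1 := le_trans hω (hDδ n ω (not_le.1 hlt))
  rw [ENNReal.ofReal_le_ofReal_iff (half_pos hε).le] at h1
  linarith

/-- Convergence in probability gives convergence of truncated means. -/
lemma VanishesInProb.tendsto_lintegral_min [∀ n, IsProbabilityMeasure (P n)]
    {D : ∀ n, Ω n → ℝ≥0∞} (h : VanishesInProb P D) :
    Tendsto (fun n => ∫⁻ ω, min 2 (D n ω) ∂(P n)) atTop (𝓝 0) := by
  refine ENNReal.tendsto_nhds_zero.2 fun ε hε => ?_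
  rcases eq_or_ne ε ⊤ with rfl | hε'
  · exact Eventually.of_forall fun _ => le_top
  have h2 : 0 < ε / 2 := ENNReal.half_pos hε.ne'
  have h4 : 0 < ε / 2 / 2 := ENNReal.half_pos h2.ne'
  filter_upwards [ENNReal.tendsto_nhds_zero.1 (h _ h2) _ h4] with n hn
  set G : Set (Ω n) := toMeasurable (P n) {ω | ε / 2 ≤ D n ω}
  have hG : MeasurableSet G := measurableSet_toMeasurable _ _
  calc ∫⁻ ω, min 2 (D n ω) ∂(P n) ≤ ∫⁻ ω, (ε / 2 + G.indicator (fun _ => 2) ω) ∂(P n) := by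
        refine lintegral_mono fun ω => ?_
        by_cases hω : ω ∈ G
        · rw [Set.indicator_of_mem hω]
          exact (min_le_left _ _).trans le_add_self
        · have : D n ω < ε / 2 := not_le.1 fun hle => hω (subset_toMeasurable _ _ hle)
          exact (min_le_right _ _).trans (this.le.trans le_self_add)
    _ = ε / 2 + 2 * P n {ω | ε / 2 ≤ D n ω} := by
        rw [lintegral_add_left measurable_const, lintegral_const, measure_univ, mul_one,
          lintegral_indicator_const hG, measure_toMeasurable]
    _ ≤ ε / 2 + 2 * (ε / 2 / 2) := by gcongr
    _ = ε := by
        rw [ENNReal.mul_div_cancel two_ne_zero ENNReal.ofNat_ne_top, ENNReal.add_halves]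

lemma vanishesInProb_of_tendsto_lintegral {D : ∀ n, Ω n → ℝ≥0∞} (hm : ∀ n, Measurable (D n))
    (h : Tendsto (fun n => ∫⁻ ω, D n ω ∂(P n)) atTop (𝓝 0)) : VanishesInProb P D := by
  refine vanishesInProb_of_ofReal fun ε hε => ?_
  have hε' : ENNReal.ofReal ε ≠ 0 := (ENNReal.ofReal_pos.2 hε).ne'
  have h0 : Tendsto (fun n => (∫⁻ ω, D n ω ∂(P n)) / ENNReal.ofReal ε) atTop (𝓝 0) := by
    simpa using ENNReal.Tendsto.div_const h (Or.inr hε')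
  exact tendsto_of_tendsto_of_tendsto_of_le_of_le tendsto_const_nhds h0 (fun _ => zero_le)
    fun n => meas_ge_le_lintegral_div (hm n).aemeasurable hε' ENNReal.ofReal_ne_top

/-- Conditional weak convergence in probability makes the statistics uniformly tight: the conditional
probability of leaving a large ball is small wherever the conditional law is close to the limit. -/
lemma exists_eventually_measure_norm_gt_le [∀ n, IsProbabilityMeasure (P n)] {β : ℕ → Type*}
    [∀ n, MeasurableSpace (β n)] {F : Type*} [NormedAddCommGroup F] [MeasurableSpace F]
    [BorelSpace F] [StandardBorelSpace F] {X : ∀ n, Ω n → β n} (hX : ∀ n, Measurable (X n))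
    {Z : ∀ n, Ω n → F} (hZ : ∀ n, Measurable (Z n)) {μ : Measure F} [IsProbabilityMeasure μ]
    (h : VanishesInProb P fun n ω => blDist (condDistrib (Z n) (X n) (P n) (X n ω)) μ)
    {η : ℝ≥0∞} (hη : 0 < η) :
    ∃ M : ℝ, ∀ᶠ n in atTop, P n {ω | M < ‖Z n ω‖} ≤ η := by
  rcases eq_or_ne η ⊤ with rfl | hη'
  · exact ⟨0, Eventually.of_forall fun _ => le_top⟩
  have h2 : 0 < η / 2 := ENNReal.half_pos hη.ne'
  have h2' : η / 2 ≠ ⊤ := (ENNReal.half_lt_self hη.ne' hη').ne_top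
  obtain ⟨M, δ, hδ, hM⟩ := exists_tight_of_blDist_lt μ (ENNReal.toReal_pos h2.ne' h2')
  rw [ENNReal.ofReal_toReal h2'] at hM
  refine ⟨M, ?_⟩
  filter_upwards [ENNReal.tendsto_nhds_zero.1 (h.tendsto_ofReal hδ) _ h2] with n hn
  have hms : MeasurableSet {z : F | M < ‖z‖} := measurableSet_lt measurable_const measurable_norm
  set A : Set (Ω n) :=
    {ω | ENNReal.ofReal δ ≤ blDist (condDistrib (Z n) (X n) (P n) (X n ω)) μ}
  have hG : MeasurableSet (toMeasurable (P n) A) := measurableSet_toMeasurable _ _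
  calc P n {ω | M < ‖Z n ω‖}
      = ∫⁻ ω, Set.indicator {z : F | M < ‖z‖} 1 (Z n ω) ∂(P n) := by
        rw [← lintegral_map (measurable_one.indicator hms) (hZ n), lintegral_indicator_one hms,
          Measure.map_apply (hZ n) hms]
        rfl
    _ = ∫⁻ ω, condDistrib (Z n) (X n) (P n) (X n ω) {z : F | M < ‖z‖} ∂(P n) := by
        rw [← lintegral_condDistrib (P n) (hX n) (hZ n) (measurable_one.indicator hms)]
        simp_rw [lintegral_indicator_one hms]
    _ ≤ ∫⁻ ω, (η / 2 + (toMeasurable (P n) A).indicator 1 ω) ∂(P n) := by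
        refine lintegral_mono fun ω => ?_
        by_cases hω : ω ∈ toMeasurable (P n) A
        · rw [Set.indicator_of_mem hω]
          exact prob_le_one.trans le_add_self
        · have : blDist (condDistrib (Z n) (X n) (P n) (X n ω)) μ < ENNReal.ofReal δ :=
            not_le.1 fun hle => hω (subset_toMeasurable _ _ hle)
          exact (hM _ inferInstance this).trans le_self_add
    _ = η / 2 + P n A := by
        rw [lintegral_add_left measurable_const, lintegral_const, measure_univ, mul_one,
          lintegral_indicator_one hG, measure_toMeasurable]
    _ ≤ η / 2 + η / 2 := by gcongr
    _ = η := ENNReal.add_halves η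

/-- Conditional continuous mapping: if `Z n` converges weakly in probability given `X n` and `T n` is
close in probability to `f (Z n)`, then `T n` converges weakly in probability given `X n` to the
image of the limit under `f`. -/
lemma vanishesInProb_blDist_condDistrib [∀ n, IsProbabilityMeasure (P n)] {β : ℕ → Type*}
    [∀ n, MeasurableSpace (β n)] {F : Type*} [NormedAddCommGroup F] [MeasurableSpace F]
    [BorelSpace F] [StandardBorelSpace F] {X : ∀ n, Ω n → β n} (hX : ∀ n, Measurable (X n))
    {Z : ∀ n, Ω n → F} (hZ : ∀ n, Measurable (Z n)) {T : ∀ n, Ω n → ℝ} (hT : ∀ n, Measurable (T n))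
    {μ : Measure F} [IsProbabilityMeasure μ] {f : F → ℝ} (hf : Measurable f)
    (hfL : ∀ M : ℝ, ∃ L : ℝ, 0 ≤ L ∧ ∀ z z' : F, ‖z‖ ≤ M → ‖z'‖ ≤ M →
      |f z - f z'| ≤ L * ‖z - z'‖)
    (h : VanishesInProb P fun n ω => blDist (condDistrib (Z n) (X n) (P n) (X n ω)) μ)
    (hTZ : VanishesInProb P fun n ω => edist (T n ω) (f (Z n ω))) :
    VanishesInProb P fun n ω => blDist (condDistrib (T n) (X n) (P n) (X n ω)) (μ.map f) := by
  set R : ∀ n, Ω n → ℝ≥0∞ := fun n ω => ∫⁻ p, min 2 (edist p.1 (f p.2))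
    ∂(condDistrib (fun ω => (T n ω, Z n ω)) (X n) (P n) (X n ω)) with hR
  have hmin : Measurable fun p : ℝ × F => min 2 (edist p.1 (f p.2)) :=
    measurable_const.min (measurable_fst.edist (hf.comp measurable_snd))
  have hRv : VanishesInProb P R := by
    refine vanishesInProb_of_tendsto_lintegral
      (fun n => hmin.lintegral_kernel.comp (hX n)) ?_
    simp only [hR, lintegral_condDistrib (P _) (hX _) ((hT _).prodMk (hZ _)) hmin]
    exact hTZ.tendsto_lintegral_min
  refine vanishesInProb_of_ofReal fun ε hε => ?_
  obtain ⟨δ, hδ, hstab⟩ := exists_integral_comp_stable μ hf hfL (show 0 < ε / 3 by linarith)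
  have hlim := (hRv.tendsto_ofReal (show 0 < ε / 3 by linarith)).add (h.tendsto_ofReal hδ)
  rw [add_zero] at hlim
  refine tendsto_of_tendsto_of_tendsto_of_le_of_le tendsto_const_nhds hlim (fun _ => zero_le)
    fun n => ?_
  refine le_trans (measure_mono_ae ?_) (measure_union_le _ _)
  filter_upwards [ae_edist_integral_condDistrib_le (P n) (hX n) (hT n) (hZ n) hf] with ω hω hle
  by_contra hnot
  have hnot' : ¬ (ENNReal.ofReal (ε / 3) ≤ R n ω ∨
    ENNReal.ofReal δ ≤ blDist (condDistrib (Z n) (X n) (P n) (X n ω)) μ) := hnot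
  rw [not_or, not_le, not_le] at hnot'
  have hbound : blDist (condDistrib (T n) (X n) (P n) (X n ω)) (μ.map f) ≤
      ENNReal.ofReal (ε / 3) + ENNReal.ofReal (ε / 3) := by
    refine iSup₂_le fun g hg => ?_
    rw [integral_map hf.aemeasurable hg.2.continuous.aestronglyMeasurable]
    refine (edist_triangle _ (∫ z, g (f z) ∂(condDistrib (Z n) (X n) (P n) (X n ω))) _).trans
      (add_le_add ((hω g hg).trans hnot'.1.le) ?_)
    rw [edist_dist, Real.dist_eq]
    exact ENNReal.ofReal_le_ofReal (hstab _ inferInstance hnot'.2 g hg)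
  have h1 : ENNReal.ofReal ε ≤ ENNReal.ofReal (ε / 3) + ENNReal.ofReal (ε / 3) :=
    le_trans hle hbound
  rw [← ENNReal.ofReal_add (by linarith) (by linarith),
    ENNReal.ofReal_le_ofReal_iff (by linarith)] at h1
  linarith

end InProb

/-! ### The corrected bootstrap statistic -/

section Bootstrap

variable {d : ℕ}

lemma ConeRegularity.zero_mem {φ : Vec d → ℝ} {θ₀ : Vec d} {C : Set (Vec d)}
    (h : ConeRegularity φ θ₀ C) : (0 : Vec d) ∈ C := by
  obtain ⟨D, hD, rfl⟩ := h.eq_zeroSet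
  have h0 := hD 0
  simp only [smul_zero, add_zero, sub_self, zero_div] at h0
  exact tendsto_nhds_unique h0 tendsto_const_nhds

open Matrix in
/-- Entrywise closeness to an invertible matrix gives operator-norm closeness of the inverses. -/
lemma exists_norm_toEuclideanCLM_inv_sub_le {S : Matrix (Fin d) (Fin d) ℝ} (hS : S.det ≠ 0) {δ : ℝ}
    (hδ : 0 < δ) : ∃ δ' : ℝ, 0 < δ' ∧ ∀ A : Matrix (Fin d) (Fin d) ℝ,
      (∀ j k, edist (A j k) (S j k) < ENNReal.ofReal δ') →
        ‖toEuclideanCLM (n := Fin d) (𝕜 := ℝ) A⁻¹ - toEuclideanCLM (n := Fin d) (𝕜 := ℝ) S⁻¹‖ ≤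
          δ := by
  have h : ContinuousAt (fun a : Fin d → Fin d → ℝ =>
      toEuclideanCLM (n := Fin d) (𝕜 := ℝ) (Matrix.of a)⁻¹) (fun j k => S j k) :=
    continuousAt_toEuclideanCLM_inv hS
  obtain ⟨δ', hδ', hA⟩ := Metric.continuousAt_iff.1 h δ hδ
  refine ⟨δ', hδ', fun A hAS => ?_⟩
  have h1 : dist (fun j k => A j k : Fin d → Fin d → ℝ) (fun j k => S j k) < δ' :=
    (dist_pi_lt_iff hδ').2 fun j => (dist_pi_lt_iff hδ').2 fun k => edist_lt_ofReal.1 (hAS j k)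
  have h2 := hA h1
  rw [dist_eq_norm] at h2
  exact h2.le

variable {Ω : ℕ → Type*} [∀ n, MeasurableSpace (Ω n)] {P : ∀ n, Measure (Ω n)}
  [∀ n, IsProbabilityMeasure (P n)] {X : ∀ n, Fin n → Ω n → Vec d} {ξ : ∀ n, Fin n → Ω n → ℝ}
  {θ₀ : Vec d} {S : Matrix (Fin d) (Fin d) ℝ} {C : Set (Vec d)} {Chat : ∀ n, Ω n → Set (Vec d)}

lemma ScoreRegularity.measurable_row (h : ScoreRegularity P X θ₀ S) (n : ℕ) :
    Measurable (row X n) :=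
  measurable_pi_iff.2 fun i => h.measurable n i

lemma measurable_bootMean (hscore : ScoreRegularity P X θ₀ S) (hξ : IsMultiplierArray P X ξ)
    (n : ℕ) : Measurable (bootMean X ξ n) :=
  measurable_multiplierMean (x := row X n) (w := row ξ n) (hscore.measurable n) (hξ.measurable n)

lemma measurable_bootStat (hscore : ScoreRegularity P X θ₀ S) (hξ : IsMultiplierArray P X ξ)
    (hboot : MultiplierBootstrap P X ξ S C Chat) (n : ℕ) : Measurable (bootStat X ξ Chat n) :=
  measurable_mahalSq (fun j k => measurable_sampleCov (x := row X n) (hscore.measurable n) j k)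
    (fun ω => posSemidef_sampleCov (row X n ω)) (measurable_bootMean hscore hξ n)
    (hboot.randomClosed n)

/-- Replacing the sample covariance and the estimated cone by their limits changes the statistic by
a quantity that vanishes in probability. -/
lemma vanishesInProb_edist_bootStat (hscore : ScoreRegularity P X θ₀ S)
    (hξ : IsMultiplierArray P X ξ) (hboot : MultiplierBootstrap P X ξ S C Chat)
    (h0 : (0 : Vec d) ∈ C) :
    VanishesInProb P fun n ω => edist (bootStat X ξ Chat n ω) (mahalSq S (bootMean X ξ n ω) C) := by
  obtain ⟨c, hc, hcoer⟩ := exists_coercive_of_posDef hscore.posDef.inv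
  refine vanishesInProb_of_ofReal fun ε hε => ENNReal.tendsto_nhds_zero.2 fun η hη => ?_
  have hη2 : 0 < η / 2 := ENNReal.half_pos hη.ne'
  obtain ⟨M, hM⟩ := exists_eventually_measure_norm_gt_le hscore.measurable_row
    (measurable_bootMean hscore hξ) hboot.clt hη2
  obtain ⟨R, δ, hδ, hstab⟩ := exists_quadDist_stable hc hcoer h0 M (half_pos hε)
  obtain ⟨δ', hδ', hinv⟩ := exists_norm_toEuclideanCLM_inv_sub_le hscore.posDef.det_pos.ne' hδ
  have hlim := ((hboot.cone R).tendsto_ofReal hδ).add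
    (tendsto_finsetSum Finset.univ fun (jk : Fin d × Fin d) _ =>
      (hscore.cov jk.1 jk.2).tendsto_ofReal hδ')
  simp only [Finset.sum_const_zero, add_zero] at hlim
  filter_upwards [hM, ENNReal.tendsto_nhds_zero.1 hlim _ hη2] with n hn1 hn2
  have hsub : {ω | ENNReal.ofReal ε ≤
        edist (bootStat X ξ Chat n ω) (mahalSq S (bootMean X ξ n ω) C)} ⊆
      {ω | M < ‖bootMean X ξ n ω‖} ∪ ({ω | ENNReal.ofReal δ ≤ truncHausdorff R (Chat n ω) C} ∪
        ⋃ jk ∈ (Finset.univ : Finset (Fin d × Fin d)), {ω | ENNReal.ofReal δ' ≤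
          edist (sampleCov (row X n ω) jk.1 jk.2) (S jk.1 jk.2)}) := by
    intro ω hω
    by_contra hnot
    simp only [Set.mem_union, Set.mem_ofPred_eq, Set.mem_iUnion, Finset.mem_univ, exists_prop,
      true_and, not_or, not_lt, not_le, not_exists, Prod.forall] at hnot hω
    obtain ⟨h1, h2, h3⟩ := hnot
    have h4 := hstab _ (bootMean X ξ n ω) (Chat n ω) h1 (hinv _ h3) h2
    rw [← mahalSq_eq_quadDist, ← mahalSq_eq_quadDist] at h4
    rw [edist_dist, Real.dist_eq, ENNReal.ofReal_le_ofReal_iff (abs_nonneg _)] at hω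
    have h5 : ε ≤ ε / 2 := hω.trans h4
    linarith
  calc P n _ ≤ _ := measure_mono hsub
    _ ≤ P n {ω | M < ‖bootMean X ξ n ω‖} +
        (P n {ω | ENNReal.ofReal δ ≤ truncHausdorff R (Chat n ω) C} +
          ∑ jk : Fin d × Fin d, P n {ω | ENNReal.ofReal δ' ≤
            edist (sampleCov (row X n ω) jk.1 jk.2) (S jk.1 jk.2)}) :=
        (measure_union_le _ _).trans (add_le_add_right ((measure_union_le _ _).trans
          (add_le_add_right (measure_biUnion_finset_le _ _) _)) _)
    _ ≤ η / 2 + η / 2 := add_le_add hn1 hn2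
    _ = η := ENNReal.add_halves η

end Bootstrap

end ScoreProfile

theorem mainTheorem3 {d : ℕ} {Ω : ℕ → Type*} [∀ n, MeasurableSpace (Ω n)]
    (P : ∀ n, MeasureTheory.Measure (Ω n)) [∀ n, MeasureTheory.IsProbabilityMeasure (P n)]
    (X : ∀ n, Fin n → Ω n → ScoreProfile.Vec d) (ξ : ∀ n, Fin n → Ω n → ℝ)
    (φ : ScoreProfile.Vec d → ℝ) (θ₀ : ScoreProfile.Vec d)
    (S : Matrix (Fin d) (Fin d) ℝ) (C : Set (ScoreProfile.Vec d))
    (Chat : ∀ n, Ω n → Set (ScoreProfile.Vec d))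
    (hscore : ScoreProfile.ScoreRegularity P X θ₀ S)
    (hcone : ScoreProfile.ConeRegularity φ θ₀ C)
    (hξ : ScoreProfile.IsMultiplierArray P X ξ)
    (hboot : ScoreProfile.MultiplierBootstrap P X ξ S C Chat) :
    ScoreProfile.TendstoWeaklyInProb P
        (ScoreProfile.condLaw P X (ScoreProfile.bootStat X ξ Chat)) (ScoreProfile.limitLaw S C) ∧
      (Continuous (fun x : ℝ => ProbabilityTheory.cdf (ScoreProfile.limitLaw S C) x) →
        ScoreProfile.VanishesInProb P fun n ω =>
          ScoreProfile.kolmogorovDist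
            (ScoreProfile.condLaw P X (ScoreProfile.bootStat X ξ Chat) n ω)
            (ScoreProfile.limitLaw S C)) := by
  have h0 := hcone.zero_mem
  obtain ⟨c, hc, hcoer⟩ := ScoreProfile.exists_coercive_of_posDef hscore.posDef.inv
  have hf : Measurable fun z => ScoreProfile.mahalSq S z C := by
    simp only [ScoreProfile.mahalSq_eq_quadDist]
    exact (ScoreProfile.continuous_quadDist hc hcoer h0).measurable
  have hfL := ScoreProfile.exists_lipschitz_quadDist hc hcoer h0
  simp only [← ScoreProfile.mahalSq_eq_quadDist] at hfL
  have hweak : ScoreProfile.TendstoWeaklyInProb P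
      (ScoreProfile.condLaw P X (ScoreProfile.bootStat X ξ Chat)) (ScoreProfile.limitLaw S C) :=
    ScoreProfile.vanishesInProb_blDist_condDistrib hscore.measurable_row
      (ScoreProfile.measurable_bootMean hscore hξ)
      (ScoreProfile.measurable_bootStat hscore hξ hboot) hf hfL hboot.clt
      (ScoreProfile.vanishesInProb_edist_bootStat hscore hξ hboot h0)
  refine ⟨hweak, fun hcdf => hweak.of_forall_exists fun ε hε => ?_⟩
  have : IsProbabilityMeasure (ScoreProfile.limitLaw S C) :=
    Measure.isProbabilityMeasure_map hf.aemeasurable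
  obtain ⟨δ, hδ, h⟩ := ScoreProfile.exists_kolmogorovDist_le hcdf hε
  refine ⟨δ, hδ, fun n ω hω => h _ ?_ hω⟩
  unfold ScoreProfile.condLaw
  infer_instance
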